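/- Write $\mathbb N=\{1,2,3,\ldots\}$. A set $\Lambda\subset\mathbb N$ is lacunary if there is a constant $\rho>1$ such that $b/a>\rho$ whenever $a<b$ are consecutive elements of $\Lambda$ in increasing order. A process is a stationary sequence $X_{\mathbb Z}=(X_n)_{n\in\mathbb Z}$ of random variables on a probability space with values in a finite set; its entropy is the conditional Shannon entropy $h(X_{\mathbb Z})=H(X_0\mid X_1,X_2,\ldots)$. A set $P\subset\mathbb N$ is totally predictive if, for every process $X_{\mathbb Z}$ with $h(X_{\mathbb Z})=0$ and every $n\in\mathbb Z$, the random variable $X_n$ is measurable with respect to the complete $\sigma$-algebra generated by $(X_p)_{p\in P}$. Proposition. If $\Lambda\subset\mathbb N$ is a finite union of lacunary sets, then $\mathbb N\setminus\Lambda$ is totally predictive. -/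

import Mathlib

universe u v

namespace LacunaryPrediction

open MeasureTheory

/-- `Λ ⊆ {1, 2, 3, …}` is lacunary with constant `ρ`: whenever `a < b` are consecutive elements
of `Λ` in increasing order, `b / a > ρ`. -/
def IsLacunaryWith (ρ : ℝ) (Λ : Set ℕ) : Prop :=
  Λ ⊆ Set.Ici 1 ∧
    ∀ a ∈ Λ, ∀ b ∈ Λ, a < b → (∀ c ∈ Λ, ¬ (a < c ∧ c < b)) → ρ < (b : ℝ) / (a : ℝ)

/-- A lacunary set: lacunary with some constant `ρ > 1`. -/
def IsLacunary (Λ : Set ℕ) : Prop :=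
  ∃ ρ : ℝ, 1 < ρ ∧ IsLacunaryWith ρ Λ

section Procs

variable {Ω : Type u} {A : Type v}

/-- A finite-valued stationary process indexed by `ℤ`: a sequence of random variables with values
in the finite discrete space `A`, whose joint law on `ℤ → A` is invariant under all shifts. -/
structure IsProcess [MeasurableSpace Ω] [MeasurableSpace A] (μ : Measure Ω) (X : ℤ → Ω → A) :
    Prop where
  measurable : ∀ n, Measurable (X n)
  stationary : ∀ k : ℤ,
    μ.map (fun ω (n : ℤ) => X (n + k) ω) = μ.map (fun ω (n : ℤ) => X n ω)

/-- The sigma-algebra generated by the random variables `X i`, `i ∈ P`. -/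
abbrev generatedSigma [MeasurableSpace A] (X : ℤ → Ω → A) (P : Set ℤ) : MeasurableSpace Ω :=
  ⨆ i ∈ P, MeasurableSpace.comap (X i) inferInstance

/-- The complete sigma-algebra generated by `X i`, `i ∈ P`: all sets that agree, up to a
`μ`-null set, with a set of `generatedSigma X P`. -/
abbrev completeSigma [MeasurableSpace Ω] [MeasurableSpace A] (μ : Measure Ω) (X : ℤ → Ω → A)
    (P : Set ℤ) : MeasurableSpace Ω :=
  eventuallyMeasurableSpace (generatedSigma X P) (ae μ)

/-- The conditional Shannon entropy `H(Y | m) = ∫ ∑ₐ -p_a log p_a dμ`, `p_a = μ(Y = a | m)`, of a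
finite-valued random variable `Y` given a sub-sigma-algebra `m`. -/
noncomputable def condEntropy [MeasurableSpace Ω] [Fintype A] (μ : Measure Ω) (Y : Ω → A)
    (m : MeasurableSpace Ω) : ℝ :=
  ∫ ω, ∑ a : A, Real.negMulLog ((μ[(Y ⁻¹' {a}).indicator (fun _ => (1 : ℝ)) | m]) ω) ∂μ

/-- The entropy `h(X) = H(X₀ | X₁, X₂, …)` of a process. Conditioning on a sigma-algebra or on its
completion gives the same value; the uncompleted one is used since it is always contained in the
sigma-algebra of `Ω`, as Mathlib's conditional expectation requires. -/
noncomputable def entropy [MeasurableSpace Ω] [MeasurableSpace A] [Fintype A] (μ : Measure Ω)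
    (X : ℤ → Ω → A) : ℝ :=
  condEntropy μ (X 0) (generatedSigma X (Set.Ici 1))

end Procs

/-- `P ⊆ {1, 2, 3, …}` is totally predictive: for every finite-valued stationary process of zero
entropy, every `X n`, `n ∈ ℤ`, is measurable with respect to the complete sigma-algebra generated
by `X p`, `p ∈ P`. -/
def IsTotallyPredictive (P : Set ℕ) : Prop :=
  P ⊆ Set.Ici 1 ∧
    ∀ (Ω : Type u) (A : Type v) [MeasurableSpace Ω] [Fintype A] [MeasurableSpace A]
      [DiscreteMeasurableSpace A] (μ : Measure Ω) [IsProbabilityMeasure μ] (X : ℤ → Ω → A),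
      IsProcess μ X → entropy μ X = 0 →
        ∀ n : ℤ, Measurable[completeSigma μ X ((fun p : ℕ => (p : ℤ)) '' P)] (X n)

end LacunaryPrediction

namespace LacunaryPrediction

/-! ### Colourings of distance graphs on `ℕ` -/

open Real

/-- The distance graph on `ℕ` with distances in `M` has finite chromatic number. -/
def IsColourable (M : Set ℕ) : Prop :=
  ∃ (K : ℕ) (c : ℕ → Fin K), ∀ s t, s < t → t - s ∈ M → c s ≠ c t

theorem IsColourable.mono {M M' : Set ℕ} (h : M ⊆ M') (hM : IsColourable M') :
    IsColourable M := by
  obtain ⟨K, c, hc⟩ := hM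
  exact ⟨K, c, fun s t hst hm => hc s t hst (h hm)⟩

theorem isColourable_of_fintype {M : Set ℕ} {C : Type*} [Fintype C] (c : ℕ → C)
    (hc : ∀ s t, s < t → t - s ∈ M → c s ≠ c t) : IsColourable M :=
  ⟨_, fun s => Fintype.equivFin C (c s), fun s t hst hm h =>
    hc s t hst hm ((Fintype.equivFin C).injective h)⟩

theorem IsColourable.union {M M' : Set ℕ} (hM : IsColourable M) (hM' : IsColourable M') :
    IsColourable (M ∪ M') := by
  obtain ⟨K, c, hc⟩ := hM
  obtain ⟨K', c', hc'⟩ := hM'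
  refine isColourable_of_fintype (fun s => (c s, c' s)) fun s t hst hm h => ?_
  rw [Prod.mk.injEq] at h
  exact hm.elim (fun hm => hc s t hst hm h.1) fun hm => hc' s t hst hm h.2

theorem IsColourable.iUnion {ι : Type*} [Fintype ι] {M : ι → Set ℕ}
    (hM : ∀ i, IsColourable (M i)) : IsColourable (⋃ i, M i) := by
  classical
  choose K c hc using hM
  refine isColourable_of_fintype (fun s i => c i s) fun s t hst hm h => ?_
  obtain ⟨i, hi⟩ := Set.mem_iUnion.1 hm
  exact hc i s t hst hi (congrFun h i)

/-- Residues modulo `T` work: a positive distance below `T` is not a multiple of `T`. -/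
theorem isColourable_lt (T : ℕ) : IsColourable {t | t < T} := by
  rcases Nat.eq_zero_or_pos T with rfl | hT
  · exact ⟨1, fun _ => 0, fun s t _ h => absurd h (by simp)⟩
  refine ⟨T, fun s => ⟨s % T, Nat.mod_lt _ hT⟩, fun s t hst hm h => ?_⟩
  have h1 : s ≡ t [MOD T] := Fin.mk.inj_iff.1 h
  have h2 := (Nat.modEq_iff_dvd' hst.le).1 h1
  exact absurd (Nat.le_of_dvd (by omega) h2) (not_le.2 hm)

/-! ### Lacunary distances: one rotation that moves every distance far from 0 -/

/-- A nested-interval step: finitely many elements of a set with ratios at least `4` can be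
multiplied into the arc where the cosine is nonpositive. -/
theorem exists_interval_cos_nonpos {M : Set ℕ} (hM0 : ∀ a ∈ M, 0 < a)
    (hM : ∀ a ∈ M, ∀ b ∈ M, a < b → 4 * a ≤ b) (N : ℕ) :
    ∃ l u : ℝ, 0 ≤ l ∧ l ≤ u ∧ u ≤ 2 ∧
      (∀ a ∈ M, a ≤ N → ∀ x ∈ Set.Icc l u, cos (2 * π * (a * x)) ≤ 0) ∧
      ∀ a ∈ M, N < a → 2 ≤ (u - l) * a := by
  induction N with
  | zero =>
    -- Length 2 suffices at the start because every element of `M` is at least 1.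
    refine ⟨0, 2, le_rfl, by norm_num, le_rfl, fun a ha h => ?_, fun a _ h => ?_⟩
    · exact absurd (hM0 a ha) (by omega)
    · have : (1 : ℝ) ≤ a := by exact_mod_cast h
      linarith
  | succ N ih =>
    obtain ⟨l, u, h0, hlu, h2, hgood, hlen⟩ := ih
    by_cases hN : N + 1 ∈ M
    swap
    · refine ⟨l, u, h0, hlu, h2, fun a ha haN => hgood a ha ?_, fun a ha haN =>
        hlen a ha (by omega)⟩
      have : a ≠ N + 1 := fun h => hN (h ▸ ha)
      omega
    have hl := hlen _ hN (by omega)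
    set q : ℝ := ((N + 1 : ℕ) : ℝ) with hq
    have hq0 : 0 < q := by positivity
    -- The interval scaled by `q` has length at least 2, so it contains `[j + 1/4, j + 3/4]`, where
    -- the cosine is nonpositive. The new length `1 / (2q)` restores the invariant because later
    -- elements are at least `4q`.
    set j : ℤ := ⌈q * l⌉ with hj
    have hj1 : q * l ≤ j := Int.le_ceil _
    have hj2 : (j : ℝ) < q * l + 1 := Int.ceil_lt_add_one _
    have e1 : l ≤ (j + 1 / 4) / q := by
      rw [le_div_iff₀ hq0]; nlinarith
    have e2 : (j + 3 / 4) / q ≤ u := by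
      rw [div_le_iff₀ hq0]; nlinarith
    refine ⟨(j + 1 / 4) / q, (j + 3 / 4) / q, h0.trans e1, by gcongr; norm_num, e2.trans h2,
      fun a ha haN x hx => ?_, fun a ha haN => ?_⟩
    · rcases Nat.lt_or_ge N a with h | h
      · obtain rfl : a = N + 1 := by omega
        have hx1 := (div_le_iff₀ hq0).1 hx.1
        have hx2 := (le_div_iff₀ hq0).1 hx.2
        have : cos (2 * π * (q * x) - j * (2 * π)) ≤ 0 := by
          apply cos_nonpos_of_pi_div_two_le_of_le <;> nlinarith [pi_pos]
        rwa [cos_sub_int_mul_two_pi] at this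
      · exact hgood a ha h x ⟨e1.trans hx.1, hx.2.trans e2⟩
    · have h4 : 4 * q ≤ a := by
        rw [hq]; exact_mod_cast hM _ hN a ha haN
      have : (j + 3 / 4) / q - (j + 1 / 4) / q = 1 / (2 * q) := by
        field_simp; ring
      rw [this, div_mul_eq_mul_div, le_div_iff₀ (by positivity)]
      linarith

theorem exists_forall_cos_nonpos {M : Set ℕ} (hM0 : ∀ a ∈ M, 0 < a)
    (hM : ∀ a ∈ M, ∀ b ∈ M, a < b → 4 * a ≤ b) :
    ∃ x : ℝ, ∀ a ∈ M, cos (2 * π * (a * x)) ≤ 0 := by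
  let G : ℕ → Set ℝ := fun N =>
    Set.Icc 0 2 ∩ ⋂ a ∈ {a | a ∈ M ∧ a ≤ N}, {x : ℝ | cos (2 * π * (a * x)) ≤ 0}
  have hclosed : ∀ N, IsClosed (G N) := fun N => isClosed_Icc.inter <|
    isClosed_biInter fun a _ => isClosed_le (by fun_prop) continuous_const
  -- Compactness of `[0, 2]` turns the finite stages into one point serving all of `M`.
  have hne : (⋂ N, G N).Nonempty := by
    apply IsCompact.nonempty_iInter_of_sequence_nonempty_isCompact_isClosed G
    · intro N x hx
      simp only [G, Set.mem_inter_iff, Set.mem_iInter, Set.mem_ofPred_eq] at hx ⊢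
      exact ⟨hx.1, fun a ha => hx.2 a ⟨ha.1, by omega⟩⟩
    · intro N
      obtain ⟨l, u, h0, hlu, h2, hgood, -⟩ := exists_interval_cos_nonpos hM0 hM N
      refine ⟨l, ⟨h0, hlu.trans h2⟩, ?_⟩
      simp only [Set.mem_iInter]
      exact fun a ha => hgood a ha.1 ha.2 l ⟨le_rfl, hlu⟩
    · exact isCompact_Icc.inter_right <|
        isClosed_biInter fun a _ => isClosed_le (by fun_prop) continuous_const
    · exact hclosed
  obtain ⟨x, hx⟩ := hne
  refine ⟨x, fun a ha => ?_⟩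
  have := (Set.mem_iInter.1 hx a).2
  simp only [Set.mem_iInter] at this
  exact this a ⟨ha, le_rfl⟩

/-- Colour `s` by the quarter of the circle containing `s * x`. Equal colours put `(t - s) * x`
within less than `1/4` of an integer, where the cosine is positive. -/
theorem isColourable_of_separated {M : Set ℕ} (hM0 : ∀ a ∈ M, 0 < a)
    (hM : ∀ a ∈ M, ∀ b ∈ M, a < b → 4 * a ≤ b) : IsColourable M := by
  obtain ⟨x, hx⟩ := exists_forall_cos_nonpos hM0 hM
  have hlt : ∀ s : ℕ, ⌊4 * Int.fract (s * x)⌋₊ < 4 := fun s => by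
    rw [Nat.floor_lt (by have := Int.fract_nonneg (s * x); positivity)]
    have := Int.fract_lt_one (s * x)
    push_cast; linarith
  refine ⟨4, fun s => ⟨_, hlt s⟩, fun s t hst hm h => ?_⟩
  have h' : ⌊4 * Int.fract (s * x)⌋₊ = ⌊4 * Int.fract (t * x)⌋₊ := by simpa using h
  have s1 := Nat.floor_le (a := 4 * Int.fract (s * x))
    (by have := Int.fract_nonneg (s * x); positivity)
  have s2 := Nat.lt_floor_add_one (4 * Int.fract (s * x))
  have t1 := Nat.floor_le (a := 4 * Int.fract (t * x))
    (by have := Int.fract_nonneg (t * x); positivity)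
  have t2 := Nat.lt_floor_add_one (4 * Int.fract (t * x))
  rw [h'] at s1 s2
  have hc := hx _ hm
  have e : 2 * π * (((t - s : ℕ) : ℝ) * x) =
      2 * π * (Int.fract (t * x) - Int.fract (s * x)) +
        ((⌊t * x⌋ - ⌊s * x⌋ : ℤ) : ℝ) * (2 * π) := by
    rw [Nat.cast_sub hst.le, Int.fract, Int.fract]; push_cast; ring
  rw [e, cos_add_int_mul_two_pi] at hc
  refine absurd hc (not_le.2 (cos_pos_of_mem_Ioo ⟨?_, ?_⟩)) <;> nlinarith [pi_pos]

/-- The successor of `a` in `L` already exceeds `ρ * a`, and `b` is at least that successor. -/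
theorem IsLacunaryWith.mul_lt {ρ : ℝ} {L : Set ℕ} (hL : IsLacunaryWith ρ L)
    {a b : ℕ} (ha : a ∈ L) (hb : b ∈ L) (hab : a < b) : ρ * a < b := by
  classical
  have hex : ∃ c, c ∈ L ∧ a < c := ⟨b, hb, hab⟩
  have hspec := Nat.find_spec hex
  have h := hL.2 a ha _ hspec.1 hspec.2 fun c hc hcc => Nat.find_min hex hcc.2 ⟨hc, hcc.1⟩
  have ha0 : (0 : ℝ) < a := by exact_mod_cast hL.1 ha
  rw [lt_div_iff₀ ha0] at h
  exact h.trans_le (by exact_mod_cast Nat.find_min' hex ⟨hb, hab⟩)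

/-- Splitting a lacunary set according to the logarithmic scale modulo `m` makes the ratios
large. -/
theorem IsLacunaryWith.pow_mul_le {ρ : ℝ} {L : Set ℕ} (hρ : 1 < ρ) (hL : IsLacunaryWith ρ L)
    {m a b : ℕ} (ha : a ∈ L) (hb : b ∈ L) (hab : a < b)
    (h : ⌊logb ρ a⌋₊ % (m + 1) = ⌊logb ρ b⌋₊ % (m + 1)) : ρ ^ m * a ≤ b := by
  have hlt := hL.mul_lt ha hb hab
  have ha1 : (1 : ℝ) ≤ a := by exact_mod_cast hL.1 ha
  have hb1 : (1 : ℝ) ≤ b := by exact_mod_cast hL.1 hb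
  have ha0 : (0 : ℝ) < a := by linarith
  have hb0 : (0 : ℝ) < b := by linarith
  have la : 0 ≤ logb ρ a := logb_nonneg hρ ha1
  have lb : 0 ≤ logb ρ b := logb_nonneg hρ hb1
  have hlog : logb ρ a + 1 < logb ρ b := by
    have := logb_lt_logb hρ (by positivity) hlt
    rw [logb_mul (by positivity) ha0.ne', logb_self_eq_one hρ] at this
    linarith
  have a1 := Nat.floor_le la
  have a2 := Nat.lt_floor_add_one (logb ρ a)
  have b1 := Nat.floor_le lb
  have b2 := Nat.lt_floor_add_one (logb ρ b)
  have hfl : ⌊logb ρ a⌋₊ < ⌊logb ρ b⌋₊ := by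
    have : (⌊logb ρ a⌋₊ : ℝ) < ⌊logb ρ b⌋₊ := by linarith
    exact_mod_cast this
  -- Distinct floors congruent modulo `m + 1` differ by at least `m + 1`; the extra 1 absorbs the
  -- rounding and leaves a logarithmic gap of at least `m`.
  have hdvd := Nat.le_of_dvd (by omega) ((Nat.modEq_iff_dvd' hfl.le).1 h)
  have hfl' : ⌊logb ρ a⌋₊ + m + 1 ≤ ⌊logb ρ b⌋₊ := by omega
  have hfl'' : (⌊logb ρ a⌋₊ : ℝ) + m + 1 ≤ ⌊logb ρ b⌋₊ := by exact_mod_cast hfl'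
  have : logb ρ (ρ ^ m * a) ≤ logb ρ b := by
    rw [logb_mul (by positivity) ha0.ne', logb_pow, logb_self_eq_one hρ]
    linarith
  exact (logb_le_logb hρ (by positivity) hb0).1 this

theorem IsLacunary.isColourable_shift {L : Set ℕ} (hL : IsLacunary L) (n : ℤ) :
    IsColourable {t : ℕ | ∃ a ∈ L, n + t = a} := by
  obtain ⟨ρ, hρ, hL⟩ := hL
  -- Ratio 8 in `L` leaves ratio 4 after subtracting `n`: from `b ≥ 8 * a` one gets `t ≥ 8 * s + 7 *
  -- n`, which is at least `4 * s` once `s > 2 * |n|`. This explains the threshold `T`.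
  obtain ⟨m, hm⟩ := pow_unbounded_of_one_lt 8 hρ
  let T : ℕ := 2 * n.natAbs + 1
  let M : Fin (m + 1) → Set ℕ := fun j =>
    {t : ℕ | T ≤ t ∧ ∃ a ∈ L, n + t = a ∧ ⌊logb ρ a⌋₊ % (m + 1) = j}
  have hMc : ∀ j, IsColourable (M j) := by
    refine fun j => isColourable_of_separated (fun t ht => by have := ht.1; omega) ?_
    rintro s ⟨hs, a, ha, hna, hja⟩ t ⟨ht, b, hb, hnb, hjb⟩ hst
    have h := hL.pow_mul_le hρ (m := m) ha hb (by omega) (hja.trans hjb.symm)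
    have h8 : 8 * a ≤ b := by
      have : (8 : ℝ) * a ≤ b := le_trans (by gcongr) h
      exact_mod_cast this
    omega
  refine ((isColourable_lt T).union (IsColourable.iUnion hMc)).mono ?_
  rintro t ⟨a, ha, hna⟩
  rcases lt_or_ge t T with h | h
  · exact Or.inl h
  · exact Or.inr (Set.mem_iUnion.2
      ⟨⟨⌊logb ρ a⌋₊ % (m + 1), Nat.mod_lt _ (by omega)⟩, h, a, ha, hna, rfl⟩)

/-- The positive `t` for which `n + t` is not observed, when only the positive times outside a
finite union of lacunary sets are observed. -/
theorem isColourable_unobserved {k : ℕ} {L : Fin k → Set ℕ} (hL : ∀ i, IsLacunary (L i))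
    (n : ℤ) :
    IsColourable {t : ℕ | ¬ ∃ p ∈ Set.Ici 1 \ ⋃ i, L i, n + t = (p : ℕ)} := by
  -- Times `n + t ≤ 0` are never observed, but they only occur for `t ≤ |n|`.
  refine ((isColourable_lt (n.natAbs + 1)).union
    (IsColourable.iUnion fun i => (hL i).isColourable_shift n)).mono fun t ht => ?_
  by_contra hcon
  simp only [Set.mem_union, Set.mem_iUnion, Set.mem_ofPred_eq, not_or, not_exists, not_lt] at hcon
  refine ht ⟨(n + t).toNat, ⟨?_, ?_⟩, ?_⟩
  · simp only [Set.mem_Ici]; omega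
  · rw [Set.mem_iUnion]
    rintro ⟨i, hi⟩
    exact hcon.2 i _ ⟨hi, by omega⟩
  · omega

/-! ### Entropy conditional on a sigma-algebra -/

open MeasureTheory Filter Topology

section Conditional

variable {Ω : Type*} {A : Type*} [Fintype A] [MeasurableSpace A] [DiscreteMeasurableSpace A]
  {m m' : MeasurableSpace Ω} {m0 : MeasurableSpace Ω} {μ : Measure Ω} [IsProbabilityMeasure μ] {Y : Ω → A}

theorem integrable_indicator_preimage (hY : Measurable Y) (a : A) :
    Integrable ((Y ⁻¹' {a}).indicator fun _ => (1 : ℝ)) μ :=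
  (integrable_const 1).indicator (hY (MeasurableSet.singleton a))

theorem condExp_indicator_mem_Icc (hY : Measurable Y) (hm : m ≤ m0)
    (a : A) :
    ∀ᵐ ω ∂μ, (μ[(Y ⁻¹' {a}).indicator (fun _ => (1 : ℝ)) | m]) ω ∈ Set.Icc (0 : ℝ) 1 := by
  have h0 : 0 ≤ᵐ[μ] μ[(Y ⁻¹' {a}).indicator (fun _ => (1 : ℝ)) | m] :=
    condExp_nonneg (Eventually.of_forall fun ω => Set.indicator_nonneg (fun _ _ => zero_le_one) ω)
  have h1 := condExp_mono (m := m) (integrable_indicator_preimage (μ := μ) hY a)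
    (integrable_const (1 : ℝ))
    (Eventually.of_forall fun ω => Set.indicator_le_self' (fun _ _ => zero_le_one) ω)
  rw [condExp_const hm] at h1
  filter_upwards [h0, h1] with ω h h' using ⟨h, h'⟩

theorem abs_negMulLog_le_one {x : ℝ} (hx : x ∈ Set.Icc (0 : ℝ) 1) : |negMulLog x| ≤ 1 := by
  rw [abs_of_nonneg (negMulLog_nonneg hx.1 hx.2)]
  linarith [negMulLog_le_one_sub_self hx.1, hx.1]

theorem integrable_negMulLog_condExp (hY : Measurable Y) (hm : m ≤ m0)
    (a : A) :
    Integrable (fun ω => negMulLog ((μ[(Y ⁻¹' {a}).indicator (fun _ => (1 : ℝ)) | m]) ω)) μ := by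
  refine Integrable.of_bound (C := 1) ?_ ?_
  · exact continuous_negMulLog.comp_aestronglyMeasurable
      integrable_condExp.aestronglyMeasurable
  · filter_upwards [condExp_indicator_mem_Icc hY hm a] with ω h using abs_negMulLog_le_one h

theorem condEntropy_eq_sum (hY : Measurable Y) (hm : m ≤ m0) :
    condEntropy μ Y m =
      ∑ a, ∫ ω, negMulLog ((μ[(Y ⁻¹' {a}).indicator (fun _ => (1 : ℝ)) | m]) ω) ∂μ :=
  integral_finsetSum _ fun a _ => integrable_negMulLog_condExp hY hm a

theorem condEntropy_nonneg (hY : Measurable Y) (hm : m ≤ m0) :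
    0 ≤ condEntropy μ Y m := by
  rw [condEntropy_eq_sum hY hm]
  refine Finset.sum_nonneg fun a _ => integral_nonneg_of_ae ?_
  filter_upwards [condExp_indicator_mem_Icc hY hm a] with ω h using negMulLog_nonneg h.1 h.2

/-- Conditioning on more information decreases entropy. -/
theorem condEntropy_anti (hY : Measurable Y) (hmm : m ≤ m')
    (hm' : m' ≤ m0) : condEntropy μ Y m' ≤ condEntropy μ Y m := by
  have hm := hmm.trans hm'
  rw [condEntropy_eq_sum hY hm, condEntropy_eq_sum hY hm']
  refine Finset.sum_le_sum fun a _ => ?_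
  set f := (Y ⁻¹' {a}).indicator (fun _ => (1 : ℝ))
  -- Conditional Jensen for the concave `negMulLog`; the tower property then identifies the outer
  -- conditional expectation.
  have hJ := concaveOn_negMulLog.condExp_map_le (μ := μ) (f := μ[f | m']) hm
    (continuous_negMulLog.upperSemicontinuous.upperSemicontinuousOn _)
    ((condExp_indicator_mem_Icc hY hm' a).mono fun ω h => h.1) isClosed_Ici
    integrable_condExp (integrable_negMulLog_condExp hY hm' a)
  have htower := condExp_condExp_of_le (f := f) (μ := μ) hmm hm'
  calc ∫ ω, negMulLog ((μ[f | m']) ω) ∂μ = ∫ ω, (μ[negMulLog ∘ μ[f | m'] | m]) ω ∂μ :=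
        (integral_condExp hm).symm
    _ ≤ ∫ ω, negMulLog ((μ[f | m]) ω) ∂μ := by
        refine integral_mono_ae integrable_condExp (integrable_negMulLog_condExp hY hm a) ?_
        filter_upwards [hJ, htower] with ω h1 h2
        rw [← h2]; exact h1

/-- Zero conditional entropy forces measurability with respect to the completion. -/
theorem measurable_of_condEntropy_eq_zero (hY : Measurable Y)
    (hm : m ≤ m0) (h : condEntropy μ Y m = 0) :
    Measurable[eventuallyMeasurableSpace m (ae μ)] Y := by
  rw [condEntropy_eq_sum hY hm] at h
  have hnn : ∀ a, 0 ≤ᵐ[μ] fun ω =>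
      negMulLog ((μ[(Y ⁻¹' {a}).indicator (fun _ => (1 : ℝ)) | m]) ω) := fun a => by
    filter_upwards [condExp_indicator_mem_Icc hY hm a] with ω h using negMulLog_nonneg h.1 h.2
  have h0 : ∀ a, MeasurableSet[eventuallyMeasurableSpace m (ae μ)] (Y ⁻¹' {a}) := by
    intro a
    have ha := (Finset.sum_eq_zero_iff_of_nonneg fun a _ =>
      integral_nonneg_of_ae (hnn a)).1 h a (Finset.mem_univ a)
    rw [integral_eq_zero_iff_of_nonneg_ae (hnn a) (integrable_negMulLog_condExp hY hm a)] at ha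
    set f := (Y ⁻¹' {a}).indicator (fun _ => (1 : ℝ)) with hf
    have hfi : Integrable f μ := integrable_indicator_preimage hY a
    -- On `[0, 1]`, `negMulLog` vanishes only at 0 and 1.
    have h01 : ∀ᵐ ω ∂μ, (μ[f | m]) ω = 0 ∨ (μ[f | m]) ω = 1 := by
      filter_upwards [ha, condExp_indicator_mem_Icc hY hm a] with ω h1 h2
      by_contra hcon
      push Not at hcon
      have h3 : negMulLog ((μ[f | m]) ω) = 0 := h1
      simp only [negMulLog, mul_eq_zero, neg_eq_zero, log_eq_zero] at h3
      rcases h3 with h3 | h3 | h3 | h3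
      · exact hcon.1 h3
      · exact hcon.1 h3
      · exact hcon.2 h3
      · have := h2.1; linarith
    -- `E` is the `m`-measurable version of `Y ⁻¹' {a}`: integrating over `E` and over its
    -- complement shows that both differences are null.
    let E : Set Ω := {ω | (μ[f | m]) ω = 1}
    have hE : MeasurableSet[m] E :=
      (stronglyMeasurable_condExp.measurable (measurableSet_singleton (1 : ℝ)))
    have hind : μ[f | m] =ᵐ[μ] E.indicator fun _ => (1 : ℝ) := by
      filter_upwards [h01] with ω h
      by_cases hω : ω ∈ E
      · rw [Set.indicator_of_mem hω]; exact hω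
      · rw [Set.indicator_of_notMem hω]; exact h.resolve_right hω
    have hYm := hY (measurableSet_singleton a)
    have hint : ∀ s, MeasurableSet[m] s → μ.real (s ∩ Y ⁻¹' {a}) = μ.real (s ∩ E) := by
      intro s hs
      have e1 := setIntegral_condExp hm hfi hs
      rw [setIntegral_congr_ae (hm _ hs) (hind.mono fun ω h _ => h), hf,
        setIntegral_indicator (hm _ hE), setIntegral_indicator hYm] at e1
      simpa using e1.symm
    refine ⟨E, hE, ?_⟩
    have i1 := hint _ hE
    have i2 := hint _ hE.compl
    rw [Set.inter_self] at i1
    rw [Set.compl_inter_self, measureReal_empty] at i2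
    have j1 : μ (Y ⁻¹' {a} \ E) = 0 := by
      rw [Set.sdiff_eq, Set.inter_comm]
      exact (measureReal_eq_zero_iff).1 i2
    have j2 : μ (E \ Y ⁻¹' {a}) = 0 := by
      have := measureReal_inter_add_sdiff (μ := μ) (s := E) hYm
      rw [i1] at this
      exact (measureReal_eq_zero_iff).1 (by linarith)
    exact (ae_le_set.2 j1).antisymm (ae_le_set.2 j2)
  intro s _
  have : Y ⁻¹' s = ⋃ a ∈ s, Y ⁻¹' {a} := by ext; simp
  rw [this]
  exact @MeasurableSet.biUnion _ _ (eventuallyMeasurableSpace m (ae μ)) _ _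
    s.to_countable fun a _ => h0 a

theorem condEntropy_eq_zero (hY : Measurable Y) (hm : m ≤ m0)
    (hYm : MeasurableSpace.comap Y inferInstance ≤ m) : condEntropy μ Y m = 0 := by
  rw [condEntropy_eq_sum hY hm]
  refine Finset.sum_eq_zero fun a _ => ?_
  have : StronglyMeasurable[m] ((Y ⁻¹' {a}).indicator fun _ => (1 : ℝ)) :=
    stronglyMeasurable_const.indicator (hYm _ ⟨{a}, measurableSet_singleton a, rfl⟩)
  rw [condExp_of_stronglyMeasurable hm this (integrable_indicator_preimage hY a)]
  refine integral_eq_zero_of_ae (Eventually.of_forall fun ω => ?_)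
  by_cases h : ω ∈ Y ⁻¹' {a} <;> simp [h]

/-- Lévy's upward theorem gives almost sure convergence of the conditional probabilities, and the
bound `|negMulLog| ≤ 1` on `[0, 1]` allows dominated convergence. -/
theorem tendsto_condEntropy (hY : Measurable Y) (ℱ : Filtration ℕ m0) :
    Tendsto (fun n => condEntropy μ Y (ℱ n)) atTop (𝓝 (condEntropy μ Y (⨆ n, ℱ n))) := by
  have hle : ⨆ n, ℱ n ≤ m0 := iSup_le fun n => ℱ.le n
  rw [funext fun n => condEntropy_eq_sum (μ := μ) hY (ℱ.le n), condEntropy_eq_sum (μ := μ) hY hle]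
  refine tendsto_finsetSum _ fun a _ => ?_
  refine tendsto_integral_of_dominated_convergence (fun _ => 1)
    (fun n => (integrable_negMulLog_condExp hY (ℱ.le n) a).aestronglyMeasurable)
    (integrable_const 1) (fun n => ?_) ?_
  · filter_upwards [condExp_indicator_mem_Icc hY (ℱ.le n) a] with ω h
      using abs_negMulLog_le_one h
  · filter_upwards [tendsto_ae_condExp (μ := μ) (ℱ := ℱ)
      ((Y ⁻¹' {a}).indicator fun _ => (1 : ℝ))] with ω h
    exact (continuous_negMulLog.tendsto _).comp h

end Conditional

/-! ### Shannon entropy and the chain rule -/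

section ShannonBasic

variable {Ω : Type*} {A B : Type*} [Fintype A] [Fintype B] [MeasurableSpace Ω] {μ : Measure Ω}
  {Y : Ω → A} {Z : Ω → B}

/-- Shannon entropy of a random variable with values in a finite set. -/
noncomputable def shannon (μ : Measure Ω) (Z : Ω → B) : ℝ :=
  ∑ b, negMulLog (μ.real (Z ⁻¹' {b}))

theorem shannon_prod_swap :
    shannon μ (fun ω => (Z ω, Y ω)) = shannon μ (fun ω => (Y ω, Z ω)) := by
  refine Fintype.sum_equiv (Equiv.prodComm B A) _ _ fun x => ?_
  congr 2
  ext ω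
  simp [Prod.ext_iff, and_comm]

theorem shannon_congr_map [MeasurableSpace B] [DiscreteMeasurableSpace B] {Z' : Ω → B} (hZ : Measurable Z) (hZ' : Measurable Z')
    (h : μ.map Z = μ.map Z') : shannon μ Z = shannon μ Z' := by
  refine Finset.sum_congr rfl fun b _ => ?_
  rw [← map_measureReal_apply hZ (measurableSet_singleton b), h,
    map_measureReal_apply hZ' (measurableSet_singleton b)]

end ShannonBasic

section Shannon

variable {Ω : Type*} {A B : Type*}
  [Fintype A] [MeasurableSpace A] [DiscreteMeasurableSpace A]
  [Fintype B] [MeasurableSpace B] [DiscreteMeasurableSpace B]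
  [MeasurableSpace Ω] {μ : Measure Ω} [IsProbabilityMeasure μ] {Y : Ω → A} {Z : Ω → B}

theorem condExp_indicator_comap (hY : Measurable Y) (hZ : Measurable Z) (a : A) :
    μ[(Y ⁻¹' {a}).indicator (fun _ => (1 : ℝ)) | MeasurableSpace.comap Z inferInstance] =ᵐ[μ]
      fun ω => μ.real (Z ⁻¹' {Z ω} ∩ Y ⁻¹' {a}) / μ.real (Z ⁻¹' {Z ω}) := by
  classical
  have hYm := hY (measurableSet_singleton a)
  let g : B → ℝ := fun b => μ.real (Z ⁻¹' {b} ∩ Y ⁻¹' {a}) / μ.real (Z ⁻¹' {b})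
  have hg : Measurable g := .of_discrete
  have hmeas : Measurable[MeasurableSpace.comap Z inferInstance] (g ∘ Z) :=
    hg.comp (comap_measurable Z)
  have hgi : Integrable (g ∘ Z) μ := by
    have : IsProbabilityMeasure (μ.map Z) := Measure.isProbabilityMeasure_map hZ.aemeasurable
    exact (Integrable.of_finite (μ := μ.map Z) (f := g)).comp_measurable hZ
  refine (ae_eq_condExp_of_forall_setIntegral_eq hZ.comap_le
    (integrable_indicator_preimage hY a) (fun s _ _ => hgi.integrableOn) ?_
    hmeas.stronglyMeasurable.aestronglyMeasurable).symm
  rintro s ⟨T, -, rfl⟩ -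
  have hT : MeasurableSet T := .of_discrete
  obtain ⟨F, rfl⟩ : ∃ F : Finset B, T = F := ⟨T.toFinset, by simp⟩
  rw [setIntegral_indicator hYm]
  have e1 : ∫ ω in Z ⁻¹' F, g (Z ω) ∂μ = ∑ b ∈ F, μ.real (Z ⁻¹' {b} ∩ Y ⁻¹' {a}) := by
    have : IsProbabilityMeasure (μ.map Z) := Measure.isProbabilityMeasure_map hZ.aemeasurable
    rw [← setIntegral_map hT hg.stronglyMeasurable.aestronglyMeasurable hZ.aemeasurable,
      setIntegral_finset _ Integrable.of_finite.integrableOn]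
    refine Finset.sum_congr rfl fun b _ => ?_
    rw [map_measureReal_apply hZ (measurableSet_singleton b), smul_eq_mul]
    -- On a null atom the quotient is 0 by the division convention, which is harmless since the
    -- numerator vanishes too.
    by_cases h0 : μ.real (Z ⁻¹' {b}) = 0
    · have : μ.real (Z ⁻¹' {b} ∩ Y ⁻¹' {a}) = 0 :=
        le_antisymm (h0 ▸ measureReal_mono Set.inter_subset_left) measureReal_nonneg
      rw [h0, this, zero_mul]
    · exact mul_div_cancel₀ _ h0
  have e2 : Z ⁻¹' F ∩ Y ⁻¹' {a} = ⋃ b ∈ F, Z ⁻¹' {b} ∩ Y ⁻¹' {a} := by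
    ext ω; simp
  have e3 : μ.real (Z ⁻¹' F ∩ Y ⁻¹' {a}) =
      ∑ b ∈ F, μ.real (Z ⁻¹' {b} ∩ Y ⁻¹' {a}) := by
    rw [e2, measureReal_biUnion_finset]
    · intro b _ b' _ hbb
      refine Set.disjoint_left.2 fun ω h h' => hbb ?_
      exact h.1.symm.trans h'.1
    · exact fun b _ => (hZ (measurableSet_singleton b)).inter hYm
  simp only [integral_const, smul_eq_mul, mul_one, measureReal_restrict_apply_univ]
  rw [e3]; exact e1

/-- Chain rule for entropy. -/
theorem shannon_prod (hY : Measurable Y) (hZ : Measurable Z) :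
    shannon μ (fun ω => (Z ω, Y ω)) =
      shannon μ Z + condEntropy μ Y (MeasurableSpace.comap Z inferInstance) := by
  classical
  have hsum : ∀ b, ∑ a, μ.real (Z ⁻¹' {b} ∩ Y ⁻¹' {a}) = μ.real (Z ⁻¹' {b}) := by
    intro b
    rw [← measureReal_biUnion_finset]
    · congr 1; ext ω; simp
    · intro a _ a' _ haa
      refine Set.disjoint_left.2 fun ω h h' => haa ?_
      exact h.2.symm.trans h'.2
    · exact fun a _ => (hZ (measurableSet_singleton b)).inter (hY (measurableSet_singleton a))
  let φ : B → ℝ := fun b =>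
    ∑ a, negMulLog (μ.real (Z ⁻¹' {b} ∩ Y ⁻¹' {a}) / μ.real (Z ⁻¹' {b}))
  have e1 : condEntropy μ Y (MeasurableSpace.comap Z inferInstance) = ∫ ω, φ (Z ω) ∂μ := by
    refine integral_congr_ae ?_
    filter_upwards [ae_all_iff.2 fun a => condExp_indicator_comap (μ := μ) hY hZ a] with ω h
    exact Finset.sum_congr rfl fun a _ => by rw [h a]
  have e2 : ∫ ω, φ (Z ω) ∂μ = ∑ b, μ.real (Z ⁻¹' {b}) * φ b := by
    have : IsProbabilityMeasure (μ.map Z) := Measure.isProbabilityMeasure_map hZ.aemeasurable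
    rw [← integral_map hZ.aemeasurable
      (Measurable.of_discrete (f := φ)).stronglyMeasurable.aestronglyMeasurable,
      integral_fintype .of_finite]
    exact Finset.sum_congr rfl fun b _ => by
      rw [map_measureReal_apply hZ (measurableSet_singleton b), smul_eq_mul]
  rw [e1, e2, shannon, shannon, Fintype.sum_prod_type, ← Finset.sum_add_distrib]
  refine Finset.sum_congr rfl fun b _ => ?_
  have hpre : ∀ a, (fun ω => (Z ω, Y ω)) ⁻¹' {(b, a)} = Z ⁻¹' {b} ∩ Y ⁻¹' {a} := by
    intro a; ext ω; simp
  simp_rw [hpre]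
  by_cases h0 : μ.real (Z ⁻¹' {b}) = 0
  · have h1 : ∀ a, μ.real (Z ⁻¹' {b} ∩ Y ⁻¹' {a}) = 0 := fun a =>
      le_antisymm (h0 ▸ measureReal_mono Set.inter_subset_left) measureReal_nonneg
    simp [h0, h1]
  -- The product rule for `negMulLog`, applied to joint = marginal × conditional. Summed over `a`,
  -- the first terms give the entropy of `Z` and the second its conditional counterpart.
  · have h1 : ∀ a, negMulLog (μ.real (Z ⁻¹' {b} ∩ Y ⁻¹' {a})) =
        μ.real (Z ⁻¹' {b} ∩ Y ⁻¹' {a}) / μ.real (Z ⁻¹' {b}) * negMulLog (μ.real (Z ⁻¹' {b})) +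
        μ.real (Z ⁻¹' {b}) *
          negMulLog (μ.real (Z ⁻¹' {b} ∩ Y ⁻¹' {a}) / μ.real (Z ⁻¹' {b})) := fun a => by
      rw [← negMulLog_mul, mul_div_cancel₀ _ h0]
    rw [Finset.sum_congr rfl fun a _ => h1 a, Finset.sum_add_distrib, ← Finset.sum_mul,
      ← Finset.sum_div, hsum, div_self h0, one_mul, Finset.mul_sum]

/-- Expand the entropy of the pair in both orders: `Z` adds nothing to `Y`, while `Y` adds something
nonnegative to `Z`. -/
theorem shannon_mono (hZ : Measurable Z) (hY : Measurable Y)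
    (h : MeasurableSpace.comap Z inferInstance ≤ MeasurableSpace.comap Y inferInstance) :
    shannon μ Z ≤ shannon μ Y := by
  have h1 := shannon_prod (μ := μ) hY hZ
  have h2 := shannon_prod (μ := μ) hZ hY
  rw [condEntropy_eq_zero hZ hY.comap_le h, shannon_prod_swap] at h2
  linarith [condEntropy_nonneg (μ := μ) hY hZ.comap_le]

end Shannon

/-! ### Stationary processes and the counting argument -/

section Stationary

variable {Ω : Type*} {A : Type*} [Fintype A] [MeasurableSpace A] [DiscreteMeasurableSpace A]
  [MeasurableSpace Ω] {μ : Measure Ω} [IsProbabilityMeasure μ] {X : ℤ → Ω → A}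

/-- The restriction of a process to a finite set of times. -/
def block (X : ℤ → Ω → A) (F : Finset ℤ) (ω : Ω) : F → A := fun i => X i ω

omit [Fintype A] [DiscreteMeasurableSpace A] in
theorem measurable_block (hX : ∀ n, Measurable (X n)) (F : Finset ℤ) : Measurable (block X F) :=
  measurable_pi_lambda _ fun i => hX i

omit [Fintype A] [DiscreteMeasurableSpace A] [MeasurableSpace Ω] in
theorem comap_block (X : ℤ → Ω → A) (F : Finset ℤ) :
    MeasurableSpace.comap (block X F) inferInstance = generatedSigma X F := by
  change MeasurableSpace.comap (block X F) MeasurableSpace.pi = _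
  simp only [MeasurableSpace.pi, MeasurableSpace.comap_iSup, MeasurableSpace.comap_comp,
    generatedSigma, Finset.mem_coe]
  rw [iSup_subtype']
  rfl

omit [Fintype A] [DiscreteMeasurableSpace A] in
theorem generatedSigma_le (hX : ∀ n, Measurable (X n)) (P : Set ℤ) :
    generatedSigma X P ≤ ‹MeasurableSpace Ω› :=
  iSup₂_le fun n _ => (hX n).comap_le

omit [Fintype A] [DiscreteMeasurableSpace A] [MeasurableSpace Ω] in
theorem generatedSigma_mono (X : ℤ → Ω → A) {P Q : Set ℤ} (h : P ⊆ Q) :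
    generatedSigma X P ≤ generatedSigma X Q :=
  biSup_mono h

theorem shannon_block_mono (hX : ∀ n, Measurable (X n)) {F G : Finset ℤ} (h : F ⊆ G) :
    shannon μ (block X F) ≤ shannon μ (block X G) := by
  refine shannon_mono (measurable_block hX F) (measurable_block hX G) ?_
  rw [comap_block, comap_block]
  exact generatedSigma_mono X (Finset.coe_subset.2 h)

/-- The enlarged block and the pair (block, `X n`) generate the same sigma-algebra, so they have
equal entropy and the chain rule applies. -/
theorem shannon_block_insert (hX : ∀ n, Measurable (X n)) (n : ℤ) (F : Finset ℤ) :
    shannon μ (block X (insert n F)) =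
      shannon μ (block X F) + condEntropy μ (X n) (generatedSigma X F) := by
  rw [← comap_block, ← shannon_prod (hX n) (measurable_block hX F)]
  have hm : Measurable fun ω => (block X F ω, X n ω) := (measurable_block hX F).prodMk (hX n)
  have hsig : MeasurableSpace.comap (fun ω => (block X F ω, X n ω)) inferInstance =
      MeasurableSpace.comap (block X (insert n F)) inferInstance := by
    refine (MeasurableSpace.comap_prodMk _ _).trans ?_
    rw [comap_block, comap_block, generatedSigma, generatedSigma,
      Finset.coe_insert, iSup_insert, sup_comm]
  exact le_antisymm (shannon_mono (measurable_block hX _) hm hsig.ge)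
    (shannon_mono hm (measurable_block hX _) hsig.le)

omit [Fintype A] [DiscreteMeasurableSpace A] [IsProbabilityMeasure μ] in
theorem IsProcess.map_comp_shift (hX : IsProcess μ X) {B : Type*} [MeasurableSpace B]
    {f : (ℤ → A) → B} (hf : Measurable f) (k : ℤ) :
    μ.map (fun ω => f fun n => X (n + k) ω) = μ.map (fun ω => f fun n => X n ω) := by
  have h := congrArg (Measure.map f) (hX.stationary k)
  rwa [Measure.map_map hf (measurable_pi_lambda _ fun n => hX.measurable _),
    Measure.map_map hf (measurable_pi_lambda _ fun n => hX.measurable _)] at h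

/-- Stationarity of conditional entropies given finitely many coordinates. -/
theorem IsProcess.condEntropy_shift (hX : IsProcess μ X) (n k : ℤ) (F : Finset ℤ) :
    condEntropy μ (X (n + k)) (generatedSigma X ((· + k) '' (F : Set ℤ))) =
      condEntropy μ (X n) (generatedSigma X F) := by
  have hX' : ∀ n, Measurable fun ω => X (n + k) ω := fun n => hX.measurable _
  have h1 : generatedSigma X ((· + k) '' (F : Set ℤ)) =
      generatedSigma (fun n => X (n + k)) (F : Set ℤ) := by
    rw [generatedSigma, iSup_image]
  -- A conditional entropy given a finite block is a difference of two block entropies, and those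
  -- depend only on the joint law.
  have hs : ∀ G : Finset ℤ,
      shannon μ (block (fun n => X (n + k)) G) = shannon μ (block X G) := fun G =>
    shannon_congr_map (measurable_block hX' G) (measurable_block hX.measurable G)
      (hX.map_comp_shift (f := fun x (i : G) => x i)
        (measurable_pi_lambda _ fun i => measurable_pi_apply _) k)
  have e1 := shannon_block_insert (μ := μ) hX' n F
  have e2 := shannon_block_insert (μ := μ) hX.measurable n F
  rw [hs, hs] at e1
  rw [h1]
  linarith

/-- A zero-entropy process has blocks of sublinear entropy. -/
theorem IsProcess.tendsto_shannon_block_div (hX : IsProcess μ X) (h0 : entropy μ X = 0) :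
    Tendsto (fun N : ℕ => shannon μ (block X (Finset.Ioc (-N : ℤ) 0)) / N) atTop (𝓝 0) := by
  let ℱ : Filtration ℕ ‹MeasurableSpace Ω› :=
    { seq := fun N => generatedSigma X (Finset.Ioc (0 : ℤ) N : Set ℤ)
      mono' := fun i j hij => generatedSigma_mono X fun x hx => by
        simp only [Finset.coe_Ioc, Set.mem_Ioc] at hx ⊢
        omega
      le' := fun N => generatedSigma_le hX.measurable _ }
  have hsup : ⨆ N, ℱ N = generatedSigma X (Set.Ici 1) := by
    refine le_antisymm (iSup_le fun N => generatedSigma_mono X fun x hx => ?_)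
      (iSup₂_le fun i hi => ?_)
    · simp only [Finset.coe_Ioc, Set.mem_Ioc, Set.mem_Ici] at hx ⊢
      omega
    · refine le_iSup_of_le i.toNat (le_iSup₂_of_le i ?_ le_rfl)
      simp only [Finset.coe_Ioc, Set.mem_Ioc, Set.mem_Ici] at hi ⊢
      omega
  have hlim := tendsto_condEntropy (μ := μ) (hX.measurable 0) ℱ
  rw [hsup] at hlim
  change Tendsto _ _ (𝓝 (entropy μ X)) at hlim
  rw [h0] at hlim
  have hempty : shannon μ (block X ∅) = 0 := by
    have h1 := shannon_block_insert (μ := μ) hX.measurable 0 ∅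
    rw [shannon]
    have : ∀ b, block X ∅ ⁻¹' {b} = Set.univ := fun b => by
      ext ω; simp [Subsingleton.elim (block X ∅ ω) b]
    simp [this]
  -- The window grows to the left, so each new coordinate is conditioned on its next `i` successors.
  -- These terms converge to the entropy, and their Cesàro means do too.
  have hsum : ∀ N : ℕ, shannon μ (block X (Finset.Ioc (-N : ℤ) 0)) =
      ∑ i ∈ Finset.range N, condEntropy μ (X 0) (ℱ i) := by
    intro N
    induction N with
    | zero => rw [Nat.cast_zero, neg_zero, Finset.Ioc_self, hempty, Finset.sum_range_zero]
    | succ N ih =>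
      have e : Finset.Ioc (-((N + 1 : ℕ) : ℤ)) 0 = insert (-(N : ℤ)) (Finset.Ioc (-N : ℤ) 0) := by
        ext x; simp only [Finset.mem_Ioc, Finset.mem_insert]; omega
      rw [e, shannon_block_insert hX.measurable, ih, Finset.sum_range_succ]
      congr 1
      have h := hX.condEntropy_shift (-(N : ℤ)) N (Finset.Ioc (-N : ℤ) 0)
      rw [← h, neg_add_cancel]
      congr 2
      ext x
      simp only [Finset.coe_Ioc, Set.image_add_const_Ioc]
      simp
  refine hlim.cesaro.congr fun N => ?_
  rw [hsum, div_eq_inv_mul]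

/-- Build `S` from its largest element downwards: by the chain rule each new minimum contributes at
least `ε`. -/
theorem mul_card_le_shannon_block (hX : ∀ n, Measurable (X n)) {ε : ℝ} (S : Finset ℤ)
    (h : ∀ s ∈ S, ∀ G ⊆ S, (∀ x ∈ G, s < x) →
      ε ≤ condEntropy μ (X s) (generatedSigma X (G : Set ℤ))) :
    ε * S.card ≤ shannon μ (block X S) := by
  induction S using Finset.induction_on_min with
  | empty =>
    simp only [Finset.card_empty, Nat.cast_zero, mul_zero]
    exact Finset.sum_nonneg fun b _ => negMulLog_nonneg measureReal_nonneg measureReal_le_one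
  | insert a S ha ih =>
    have hna : a ∉ S := fun h => lt_irrefl _ (ha a h)
    rw [Finset.card_insert_of_notMem hna, shannon_block_insert hX]
    have h1 := ih fun s hs G hG => h s (Finset.mem_insert_of_mem hs) G
      (hG.trans (Finset.subset_insert _ _))
    have h2 := h a (Finset.mem_insert_self _ _) S (Finset.subset_insert _ _) ha
    push_cast
    linarith

/-- If the distances `t ≥ 1` with `n + t` unobserved are colourable, then a zero-entropy process
is determined at time `n` by its observed values. -/
theorem IsProcess.condEntropy_eq_zero_of_isColourable (hX : IsProcess μ X)
    (h0 : entropy μ X = 0) {n : ℤ} {P : Set ℤ} (hP : IsColourable {t : ℕ | n + t ∉ P}) :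
    condEntropy μ (X n) (generatedSigma X P) = 0 := by
  classical
  have hle := generatedSigma_le hX.measurable P
  refine le_antisymm ?_ (condEntropy_nonneg (hX.measurable n) hle)
  set ε := condEntropy μ (X n) (generatedSigma X P)
  obtain ⟨K, c, hc⟩ := hP
  have key : ∀ N : ℕ, ε * N ≤ K * shannon μ (block X (Finset.Ioc (-N : ℤ) 0)) := by
    intro N
    let T : Fin K → Finset ℕ := fun j => {s ∈ Finset.range N | c s = j}
    -- Moves `0, …, N - 1` onto the window `(-N, 0]`, preserving order and distances.
    let e : ℕ ↪ ℤ := ⟨fun s => (s : ℤ) + 1 - N, fun s t h => by simpa using h⟩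
    have he : ∀ s, e s = (s : ℤ) + 1 - N := fun _ => rfl
    have hT : ∀ j, ε * (T j).card ≤ shannon μ (block X (Finset.Ioc (-N : ℤ) 0)) := by
      intro j
      have hsub : (T j).map e ⊆ Finset.Ioc (-N : ℤ) 0 := by
        intro x hx
        obtain ⟨s, hs, rfl⟩ := Finset.mem_map.1 hx
        have := Finset.mem_range.1 (Finset.mem_filter.1 hs).1
        rw [he, Finset.mem_Ioc]
        omega
      refine le_trans ?_ (shannon_block_mono hX.measurable hsub)
      rw [← Finset.card_map e]
      refine mul_card_le_shannon_block hX.measurable _ fun x hx G hG hlt => ?_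
      obtain ⟨s, hs, rfl⟩ := Finset.mem_map.1 hx
      -- Translate `e s` to `n`. A later point `e t` of the same colour lands on `n + (t - s)`,
      -- which lies in `P` because `t - s` is not a forbidden distance; conditioning on less than
      -- `P` leaves entropy at least `ε`.
      rw [← hX.condEntropy_shift _ (n - e s) G, add_sub_cancel]
      refine condEntropy_anti (hX.measurable n) (generatedSigma_mono X ?_) hle
      rintro _ ⟨y, hy, rfl⟩
      obtain ⟨t, ht, rfl⟩ := Finset.mem_map.1 (hG hy)
      have hst := hlt _ hy
      simp only [he] at hst ⊢
      have hst' : s < t := by omega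
      by_contra hcon
      refine hc s t hst' ?_ ((Finset.mem_filter.1 hs).2.trans (Finset.mem_filter.1 ht).2.symm)
      have : n + ((t - s : ℕ) : ℤ) = (t : ℤ) + 1 - N + (n - ((s : ℤ) + 1 - N)) := by omega
      rw [Set.mem_ofPred_eq, this]
      exact hcon
    have hcard : N = ∑ j, (T j).card := by
      conv_lhs => rw [← Finset.card_range N]
      exact Finset.card_eq_sum_card_fiberwise fun _ _ => Finset.mem_coe.2 (Finset.mem_univ _)
    calc ε * N = ∑ j, ε * (T j).card := by
          conv_lhs => rw [hcard]
          rw [Nat.cast_sum, Finset.mul_sum]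
      _ ≤ ∑ _j : Fin K, shannon μ (block X (Finset.Ioc (-N : ℤ) 0)) :=
          Finset.sum_le_sum fun j _ => hT j
      _ = _ := by simp
  have hlim := (hX.tendsto_shannon_block_div h0).const_mul (K : ℝ)
  rw [mul_zero] at hlim
  refine ge_of_tendsto hlim ?_
  filter_upwards [eventually_gt_atTop 0] with N hN
  rw [← mul_div_assoc, le_div_iff₀ (by exact_mod_cast hN)]
  exact key N

end Stationary

end LacunaryPrediction

theorem mainTheorem8 (k : ℕ) (L : Fin k → Set ℕ)
    (hL : ∀ i, LacunaryPrediction.IsLacunary (L i)) :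
    LacunaryPrediction.IsTotallyPredictive.{u, v} (Set.Ici 1 \ ⋃ i, L i) := by
  refine ⟨Set.sdiff_subset, fun Ω A _ _ _ _ μ _ X hX h0 n => ?_⟩
  refine LacunaryPrediction.measurable_of_condEntropy_eq_zero (hX.measurable n)
    (LacunaryPrediction.generatedSigma_le hX.measurable _)
    (hX.condEntropy_eq_zero_of_isColourable h0 ?_)
  refine (LacunaryPrediction.isColourable_unobserved hL n).mono fun t ht => ?_
  rintro ⟨p, hp, h⟩
  exact ht ⟨p, hp, h.symm⟩
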